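/- A Dyck path is a lattice path that starts at the origin, ends on the $x$-axis, never goes below it, and consists of steps $U=(1,1)$ and $D=(1,-1)$. Its semi-length $\ell(P)$ is its number of $U$ steps, and its number of peaks $\rho(P)$ is its number of subpaths $UD$. Let $\nu_1,\dots,\nu_k$ be the heights, from left to right, of the lowest points of its subpaths $DU$ (its valleys). For $d\in\mathbb Z$, the path is called $d$-Dyck if $\nu_{i+1}-\nu_i\ge d$ for all $1\le i<k$ (no condition if $k\le 1$). Let $d<0$ be an integer, let $e=|d|\ge 1$, and let $$L_e(x,y)=\sum_{P}x^{\ell(P)}y^{\rho(P)},$$ where $P$ runs over all nonempty $d$-Dyck paths. Then, as formal power series in $x$ over $\mathbb Q$, $$L_e(x,1)=\sum_{n\ge 1}\frac{\displaystyle\sum_{2i_2+\cdots+(e+1)i_{e+1}=n-1}\binom{n}{i_2,\ldots,i_{e+1}}\,x^{\,n-i_2-\cdots-i_{e+1}}\;t^{\,i_{e+1}}\prod_{j=2}^{e}\left(x\binom{e+2}{j}-\binom{e}{j-1}\right)^{i_j}}{n\,(1-(e+2)x)^n},$$ where the inner sum is over tuples $(i_2,\dots,i_{e+1})$ of nonnegative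 integers, $$\binom{n}{i_2,\ldots,i_{e+1}}=\frac{n!}{i_2!\cdots i_{e+1}!\,(n-i_2-\cdots-i_{e+1})!},\qquad t=\frac{(e+2)x(1-x)-1+x(1+x)}{1-x},$$ and the outer series converges unconditionally in the usual topology of formal power series: each coefficient of $x^m$ receives nonzero contributions from only finitely many $n$. -/

import Mathlib

open scoped PowerSeries

/-- The heights, from left to right, of the valley vertices (the lowest points of the subpaths `DU`)
of a lattice path with steps `U = (1,1)` and `D = (1,-1)` that starts at height `h`. -/
def valleysFrom : ℤ → List DyckStep → List ℤ
  | _, [] => []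
  | h, DyckStep.U :: l => valleysFrom (h + 1) l
  | h, DyckStep.D :: l =>
      if l.head? = some DyckStep.U then (h - 1) :: valleysFrom (h - 1) l
      else valleysFrom (h - 1) l

/-- The number of peaks (subpaths `UD`) of a lattice path. -/
def peaksOf : List DyckStep → ℕ
  | [] => 0
  | DyckStep.U :: l => (if l.head? = some DyckStep.D then 1 else 0) + peaksOf l
  | DyckStep.D :: l => peaksOf l

/-- The valley vertices vector `ν = (ν₁, …, ν_k)` of a Dyck path. -/
def DyckWord.valleys (p : DyckWord) : List ℤ := valleysFrom 0 p.toList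

/-- The number `ρ(P)` of peaks of a Dyck path. -/
def DyckWord.peaks (p : DyckWord) : ℕ := peaksOf p.toList

/-- A Dyck path is (restricted) `d`-Dyck if `ν_{i+1} - ν_i ≥ d` for all consecutive valleys; there is
no condition if it has at most one valley. -/
def DyckWord.IsRestricted (d : ℤ) (p : DyckWord) : Prop :=
  p.valleys.IsChain fun a b => d ≤ b - a

instance DyckWord.decidablePredIsRestricted (d : ℤ) : DecidablePred (DyckWord.IsRestricted d) := fun p =>
  inferInstanceAs (Decidable (p.valleys.IsChain fun a b => d ≤ b - a))

/-- The generating function `∑ x ^ ℓ(P) * y ^ ρ(P)` over the nonempty `d`-Dyck paths `P`, where `ℓ` is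
the semi-length, as a power series in `x` whose coefficients are polynomials in `y`. -/
noncomputable def dyckGF (d : ℤ) : (Polynomial ℚ)⟦X⟧ :=
  PowerSeries.mk fun n =>
    ∑ p : {p : DyckWord // p.semilength = n} with p.1 ≠ 0 ∧ p.1.IsRestricted d,
      (Polynomial.X : Polynomial ℚ) ^ p.1.peaks

/-- The specialization `y = 1` of a power series in `x` with coefficients polynomials in `y`. -/
noncomputable def atYOne (F : (Polynomial ℚ)⟦X⟧) : ℚ⟦X⟧ :=
  PowerSeries.map (Polynomial.evalRingHom (1 : ℚ)) F

/-- The (unconditional) sum of a family of formal power series, in the usual topology of the ring of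
formal power series: coefficientwise convergence, the field `ℚ` of coefficients being discrete. -/
def HasFormalSum {ι : Type*} (f : ι → ℚ⟦X⟧) (a : ℚ⟦X⟧) : Prop :=
  letI : TopologicalSpace ℚ⟦X⟧ := @PowerSeries.WithPiTopology.instTopologicalSpace ℚ ⊥
  HasSum f a

/-- The tuples `(i_2, …, i_{e+1})` of natural numbers with `2 i_2 + ⋯ + (e+1) i_{e+1} = n - 1`, as
functions on `ℕ` that vanish outside `{2, …, e+1}`, for `n ≥ 1`. The bound `i_j < n` loses no tuple, see
`mem_indexTuples`. -/
noncomputable def indexTuples (e n : ℕ) : Finset (ℕ →₀ ℕ) :=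
  ((Finset.Icc 2 (e + 1)).finsupp fun _ => Finset.range n).filter fun i =>
    ∑ j ∈ Finset.Icc 2 (e + 1), j * i j = n - 1

theorem mem_indexTuples {e n : ℕ} (hn : 1 ≤ n) (i : ℕ →₀ ℕ) :
    i ∈ indexTuples e n ↔
      i.support ⊆ Finset.Icc 2 (e + 1) ∧ ∑ j ∈ Finset.Icc 2 (e + 1), j * i j = n - 1 := by
  rw [indexTuples, Finset.mem_filter, Finset.mem_finsupp_iff]
  refine ⟨fun h => ⟨h.1.1, h.2⟩, fun h => ⟨⟨h.1, fun j hj => ?_⟩, h.2⟩⟩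
  have h1 : j * i j ≤ ∑ j ∈ Finset.Icc 2 (e + 1), j * i j :=
    Finset.single_le_sum (f := fun j => j * i j) (fun _ _ => Nat.zero_le _) hj
  have h2 : i j ≤ j * i j := Nat.le_mul_of_pos_left _ (by have := (Finset.mem_Icc.1 hj).1; omega)
  exact Finset.mem_range.2 (by omega)

/-- `i_2 + ⋯ + i_{e+1}`. -/
def tupleSum (e : ℕ) (i : ℕ →₀ ℕ) : ℕ := ∑ j ∈ Finset.Icc 2 (e + 1), i j

/-- The multinomial coefficient `n! / (i_2! ⋯ i_{e+1}! (n - i_2 - ⋯ - i_{e+1})!)`. -/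
def multinom (e n : ℕ) (i : ℕ →₀ ℕ) : ℚ :=
  (n.factorial : ℚ) /
    ((∏ j ∈ Finset.Icc 2 (e + 1), ((i j).factorial : ℚ)) * ((n - tupleSum e i).factorial : ℚ))

/-- `t = ((e+2) x (1-x) - 1 + x (1+x)) / (1-x)`, as a formal power series in `x`. -/
noncomputable def tSeries (e : ℕ) : ℚ⟦X⟧ :=
  (((e : ℚ⟦X⟧) + 2) * PowerSeries.X * (1 - PowerSeries.X) - 1
    + PowerSeries.X * (1 + PowerSeries.X)) * (1 - PowerSeries.X)⁻¹

/-! Cut a path at its valleys. Let F_m(x) count what may follow a valley of height m; the only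
memory needed is that height, which bounds the next valley below by m - e. Raising the remembered
height from m to m + 1 forbids exactly one position of the next valley, height m - e. Hence
differences in the remembered height are explicit multiples of F_{m-e}, and G(u) = ∑ F_m u^m
satisfies a linear equation k(u) G(u) = x(1 + F_0) u - x F_0 (`kernel_equation`). The origin behaves
like a valley of height 0, so F_0 = L_e(x,1) (`atYOne_dyckGF`).

A root u of k with x ∣ u kills the left side, so F_0 = u/(1 - u). Writing u = T/(1 + T) gives F_0 =
T (`eq_of_kernel_equation`). In terms of T, clearing denominators in k(u) = 0 makes the T^(e+2)
terms cancel. Isolating the linear term, whose coefficient is 1 - (e+2)x, leaves T = P(T), where P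
is `lagrangePoly`: no linear term, constant term divisible by x.

Lagrange inversion (`exists_hasSum`) produces such a T as ∑ (1/n) [u^(n-1)] P(u)^n, convergent
x-adically. The multinomial theorem turns each term into the stated inner sum (`term_lagrangePoly`).
-/

namespace PowerSeries

theorem eq_zero_of_forall_X_pow_dvd {R : Type*} [CommRing R] {f : R⟦X⟧}
    (h : ∀ s : ℕ, X ^ s ∣ f) : f = 0 := by
  ext n
  exact X_pow_dvd_iff.1 (h (n + 1)) n n.lt_succ_self

end PowerSeries

/-! ### Lagrange inversion for T = P(T), through a linear recurrence for the powers of T. -/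

namespace LagrangeInversion

open Polynomial

variable {K : Type*} [Field K]

/-- The `n`-th term `(k / n) [u ^ n] (u ^ k P(u) ^ n)` of the Lagrange expansion of `T ^ k`,
where `T = P(T)`. -/
noncomputable def term (P : Polynomial K⟦X⟧) (k n : ℕ) : K⟦X⟧ :=
  if n = 0 then (if k = 0 then 1 else 0)
  else PowerSeries.C ((k : K) / n) * (X ^ k * P ^ n).coeff n

theorem sum_coeff_mul_X_pow {R : Type*} [CommRing R] (P : Polynomial R) (k : ℕ) :
    ∑ j ∈ Finset.range (P.natDegree + 1), C (P.coeff j * ((j + k : ℕ) : R)) * X ^ (j + k)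
      = X * derivative (X ^ k * P) := by
  conv_rhs => rw [P.as_sum_range_C_mul_X_pow]
  rw [Finset.mul_sum, map_sum, Finset.mul_sum]
  refine Finset.sum_congr rfl fun j _ => ?_
  rw [show (X : Polynomial R) ^ k * (C (P.coeff j) * X ^ j) = C (P.coeff j) * X ^ (j + k) by ring,
    derivative_C_mul_X_pow]
  rcases Nat.eq_zero_or_pos (j + k) with h | h
  · simp [h]
  · obtain ⟨m, hm⟩ := Nat.exists_eq_succ_of_ne_zero h.ne'
    rw [hm]
    simp only [Nat.succ_eq_add_one, Nat.add_sub_cancel]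
    ring

theorem euler_identity {R : Type*} [CommRing R] (P : Polynomial R) (k n : ℕ) :
    ((n + 1 : ℕ) : Polynomial R) * (X * (X * derivative (X ^ k * P) * P ^ n))
      = X * derivative (X ^ (k + 1) * P ^ (n + 1)) - ((k + 1 : ℕ) : Polynomial R) *
          (X ^ (k + 1) * P ^ (n + 1))
        + ((n + 1 : ℕ) : Polynomial R) * (k : Polynomial R) * (X ^ (k + 1) * P ^ (n + 1)) := by
  have hX : (X : Polynomial R) * derivative (X ^ k) = (k : Polynomial R) * X ^ k := by
    rcases k with _ | k
    · simp
    · simp only [derivative_X_pow_succ]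
      push_cast
      simp
      ring
  have hP : derivative (P ^ (n + 1)) = ((n + 1 : ℕ) : Polynomial R) * P ^ n * derivative P := by
    rw [derivative_pow_succ]
    push_cast
    simp
  have hk : derivative ((X : Polynomial R) ^ (k + 1)) = ((k + 1 : ℕ) : Polynomial R) * X ^ k := by
    rw [derivative_X_pow_succ]
    push_cast
    simp
  rw [derivative_mul, derivative_mul, hP, hk]
  linear_combination ((n + 1 : ℕ) : Polynomial R) * X * P ^ (n + 1) * hX

/-- The operator X · d/dX multiplies the coefficient of X^(n+1) by n + 1, so `euler_identity` yields
the scalar (n+1) - (k+1) + (n+1)k = (k+1)n. -/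
theorem coeff_euler {R : Type*} [CommRing R] (P : Polynomial R) (k n : ℕ) :
    ((n + 1 : ℕ) : R) * (X * derivative (X ^ k * P) * P ^ n).coeff n
      = ((k + 1 : ℕ) : R) * (n : R) * (X ^ (k + 1) * P ^ (n + 1)).coeff (n + 1) := by
  have h := congrArg (fun Q => Q.coeff (n + 1)) (euler_identity P k n)
  simp only [coeff_add, coeff_sub, mul_assoc, coeff_natCast_mul, coeff_X_mul] at h
  rw [coeff_derivative] at h
  simp only [mul_assoc]
  rw [h]
  push_cast
  ring

/-- Termwise form of T^(k+1) = P(T) T^k: summed over n it becomes a linear recurrence in k for the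
candidate powers of T. -/
theorem term_succ [CharZero K] (P : Polynomial K⟦X⟧) (k n : ℕ) :
    term P (k + 1) (n + 1)
      = ∑ j ∈ Finset.range (P.natDegree + 1), P.coeff j * term P (j + k) n := by
  rcases Nat.eq_zero_or_pos n with rfl | hn
  · rcases Nat.eq_zero_or_pos k with rfl | hk
    · rw [Finset.sum_eq_single_of_mem 0 (by simp) (fun j _ hj => by simp [term, hj])]
      simp [term, coeff_X_mul P 0]
    · rw [Finset.sum_eq_zero (fun j _ => by simp [term, hk.ne'])]
      simp only [term, coeff_X_pow_mul']
      simp [hk.ne']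
  · have hn' : (n : K) ≠ 0 := by exact_mod_cast hn.ne'
    have hn1 : (n : K) + 1 ≠ 0 := by exact_mod_cast n.succ_ne_zero
    set c := (X ^ (k + 1) * P ^ (n + 1)).coeff (n + 1) with hc
    have key : ∑ j ∈ Finset.range (P.natDegree + 1), P.coeff j * term P (j + k) n
        = PowerSeries.C ((n : K)⁻¹) * (X * derivative (X ^ k * P) * P ^ n).coeff n := by
      rw [← sum_coeff_mul_X_pow, Finset.sum_mul, finsetSum_coeff, Finset.mul_sum]
      refine Finset.sum_congr rfl fun j _ => ?_
      rw [mul_assoc (C _), coeff_C_mul, term, if_neg hn.ne', div_eq_mul_inv, map_mul, map_natCast]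
      ring
    have h2 := coeff_euler P k n
    rw [← hc] at h2
    rw [key, term, if_neg n.succ_ne_zero, ← hc]
    have h3 : PowerSeries.C ((n : K)⁻¹) * PowerSeries.C ((n : K) + 1)⁻¹ *
        PowerSeries.C ((n : K) + 1) * (X * derivative (X ^ k * P) * P ^ n).coeff n
        = PowerSeries.C ((n : K)⁻¹) * PowerSeries.C ((n : K) + 1)⁻¹ *
          (PowerSeries.C ((k : K) + 1) * PowerSeries.C (n : K) * c) := by
      rw [mul_assoc _ (PowerSeries.C ((n : K) + 1))]
      congr 1
      simpa using h2
    rw [← map_mul, ← map_mul, inv_mul_cancel_right₀ hn1] at h3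
    rw [h3, ← map_mul, ← mul_assoc, ← map_mul]
    congr 2
    push_cast
    field_simp

/-- As P has no linear term, a contribution to degree r uses at most r/2 nonconstant factors; each
of the remaining factors, at least n - r/2 of them, is the constant term and brings a factor x. -/
theorem X_pow_dvd_coeff_pow {P : Polynomial K⟦X⟧} (h0 : PowerSeries.X ∣ P.coeff 0)
    (h1 : P.coeff 1 = 0) (n r s : ℕ) (h : 2 * s + r ≤ 2 * n + 1) :
    PowerSeries.X ^ s ∣ (P ^ n).coeff r := by
  induction n generalizing r s with
  | zero =>
    obtain rfl : s = 0 := by omega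
    simp
  | succ n ih =>
    rw [pow_succ, coeff_mul]
    refine Finset.dvd_sum fun ⟨i, j⟩ hij => ?_
    have hij' : i + j = r := by simpa using hij
    match j, hij' with
    | 0, hij' =>
      rcases s with _ | s
      · simp
      · rw [pow_succ]
        exact mul_dvd_mul (ih _ _ (by omega)) h0
    | 1, _ => simp [h1]
    | j + 2, hij' => exact Dvd.dvd.mul_right (ih _ _ (by omega)) _

theorem X_pow_dvd_term {P : Polynomial K⟦X⟧} (h0 : PowerSeries.X ∣ P.coeff 0)
    (h1 : P.coeff 1 = 0) (k n s : ℕ) (h : 2 * s ≤ n + k + 1) :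
    PowerSeries.X ^ s ∣ term P k n := by
  rw [term]
  split_ifs with hn hk
  · obtain rfl : s = 0 := by omega
    simp
  · simp
  · refine Dvd.dvd.mul_left ?_ _
    rw [coeff_X_pow_mul']
    split_ifs with hkn
    · exact X_pow_dvd_coeff_pow h0 h1 _ _ _ (by omega)
    · simp

theorem X_pow_self_dvd_term {P : Polynomial K⟦X⟧} (h0 : PowerSeries.X ∣ P.coeff 0)
    (h1 : P.coeff 1 = 0) (k n : ℕ) :
    PowerSeries.X ^ k ∣ term P k n := by
  rcases le_or_gt k n with h | h
  · exact X_pow_dvd_term h0 h1 _ _ _ (by omega)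
  · rw [term, coeff_X_pow_mul', if_neg (not_le.2 h)]
    split_ifs with hn hk
    · simp [hk]
    · simp
    · simp

/-- A triangular linear system has only the zero solution. -/
theorem linear_system_unique {P : Polynomial K⟦X⟧} (h0 : PowerSeries.X ∣ P.coeff 0)
    (h1 : P.coeff 1 = 0) {D : ℕ → K⟦X⟧} (hD0 : D 0 = 0)
    (hdvd : ∀ k, PowerSeries.X ^ k ∣ D k)
    (hD : ∀ k, D (k + 1) = ∑ j ∈ Finset.range (P.natDegree + 1), P.coeff j * D (j + k)) (k : ℕ) :
    D k = 0 := by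
  -- Double induction. In the recurrence for `D (k + 1)`, the term j = 0 gains an x from `P.coeff
  -- 0`, and the terms with index at least k + 2 gain one from the previous s. The term j = 1 would
  -- gain nothing, but it is absent.
  have main : ∀ s k, PowerSeries.X ^ (k + s) ∣ D k := by
    intro s
    induction s with
    | zero => exact hdvd
    | succ s ihs =>
      intro k
      induction k with
      | zero => simp [hD0]
      | succ k ihk =>
        rw [hD]
        refine Finset.dvd_sum fun j _ => ?_
        match j with
        | 0 =>
          rw [show k + 1 + (s + 1) = 1 + (k + (s + 1)) by ring, pow_add, pow_one, zero_add]
          exact mul_dvd_mul h0 ihk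
        | 1 => simp [h1]
        | j + 2 =>
          exact Dvd.dvd.mul_left ((pow_dvd_pow _ (by omega)).trans (ihs (j + 2 + k))) _
  exact PowerSeries.eq_zero_of_forall_X_pow_dvd fun s =>
    (pow_dvd_pow _ (Nat.le_add_left s k)).trans (main s k)

section Topology

open scoped PowerSeries.WithPiTopology

variable [TopologicalSpace K]

theorem summable_term {P : Polynomial K⟦X⟧} (h0 : PowerSeries.X ∣ P.coeff 0)
    (h1 : P.coeff 1 = 0) (k : ℕ) : Summable (term P k) := by
  rw [PowerSeries.WithPiTopology.summable_iff_summable_coeff]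
  intro d
  refine summable_of_hasFiniteSupport ((Set.finite_le_nat (2 * d + 2)).subset fun n hn => ?_)
  by_contra hlt
  rw [Set.mem_ofPred_eq] at hlt
  exact hn (PowerSeries.X_pow_dvd_iff.1
    (X_pow_dvd_term h0 h1 k n (d + 1) (by omega)) d d.lt_succ_self)

/-- Lagrange inversion: the series `∑ (1 / n) [u ^ (n - 1)] P(u) ^ n` converges to a solution of
`T = P(T)` with zero constant coefficient. -/
theorem exists_hasSum [CharZero K] [DiscreteTopology K] {P : Polynomial K⟦X⟧} (h0 : PowerSeries.X ∣ P.coeff 0)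
    (h1 : P.coeff 1 = 0) :
    ∃ T : K⟦X⟧, HasSum (term P 1) T ∧ PowerSeries.X ∣ T ∧ P.eval T = T := by
  set B : ℕ → K⟦X⟧ := fun k => ∑' n, term P k n with hB
  have hs : ∀ k, HasSum (term P k) (B k) := fun k => (summable_term h0 h1 k).hasSum
  have hB0 : B 0 = 1 := by
    refine (hs 0).unique ?_
    convert hasSum_ite_eq (0 : ℕ) (1 : K⟦X⟧) using 2 with n
    simp [term]
  have hdvd : ∀ k, PowerSeries.X ^ k ∣ B k := by
    intro k
    rw [PowerSeries.X_pow_dvd_iff]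
    intro m hm
    refine (((PowerSeries.WithPiTopology.hasSum_iff_hasSum_coeff K).1 (hs k)) m).unique ?_
    convert hasSum_zero with n
    exact PowerSeries.X_pow_dvd_iff.1 (X_pow_self_dvd_term h0 h1 k n) m hm
  have hrec : ∀ k, B (k + 1) =
      ∑ j ∈ Finset.range (P.natDegree + 1), P.coeff j * B (j + k) := by
    intro k
    have h := (hasSum_nat_add_iff' 1).2 (hs (k + 1))
    rw [Finset.sum_range_one, show term P (k + 1) 0 = 0 by simp [term], sub_zero] at h
    refine h.unique ?_
    simp_rw [term_succ]
    exact hasSum_sum fun j _ => (hs (j + k)).mul_left _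
  -- For fixed l, both sides solve the same recurrence in k with the same value at k = 0, so
  -- uniqueness makes B multiplicative. Hence B k = (B 1)^k, and the recurrence at k = 0 reads B 1 =
  -- P(B 1).
  have hmul : ∀ l k, B (k + l) = B k * B l := by
    intro l k
    refine sub_eq_zero.1 (linear_system_unique h0 h1 (D := fun k => B (k + l) - B k * B l)
      ?_ ?_ ?_ k)
    · simp [hB0]
    · intro k
      exact dvd_sub ((pow_dvd_pow _ (Nat.le_add_right k l)).trans (hdvd _)) ((hdvd k).mul_right _)
    · intro k
      rw [show k + 1 + l = (k + l) + 1 by ring, hrec, hrec, Finset.sum_mul,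
        ← Finset.sum_sub_distrib]
      refine Finset.sum_congr rfl fun j _ => ?_
      rw [← add_assoc]
      ring
  have hpow : ∀ k, B k = B 1 ^ k := by
    intro k
    induction k with
    | zero => simp [hB0]
    | succ k ih => rw [hmul, ih, pow_succ]
  refine ⟨B 1, hs 1, by simpa using hdvd 1, ?_⟩
  have h := hrec 0
  rw [zero_add] at h
  rw [eval_eq_sum_range, h]
  refine Finset.sum_congr rfl fun j _ => ?_
  rw [← h, add_zero, hpow j]

end Topology

end LagrangeInversion

/-! ### The kernel method. -/

namespace KernelMethod

variable {K : Type*} [Field K]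

/-- Comparing coefficients gives M_n = u M_{n+1} for n ≥ 1, so M_1 is divisible by every power of u
and vanishes. Then M_0 = α and β = u M_0. -/
theorem eq_of_X_sub_C_mul {u α β : K⟦X⟧} (hu : PowerSeries.X ∣ u) {M : (K⟦X⟧)⟦X⟧}
    (h : (PowerSeries.X - PowerSeries.C u) * M
      = PowerSeries.C α * PowerSeries.X - PowerSeries.C β) : β = α * u := by
  have h0 := congrArg (PowerSeries.coeff 0) h
  have hs : ∀ n, PowerSeries.coeff n M - u * PowerSeries.coeff (n + 1) M
      = if n = 0 then α else 0 := by
    intro n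
    have := congrArg (PowerSeries.coeff (n + 1)) h
    simpa [sub_mul, PowerSeries.coeff_succ_X_mul, PowerSeries.coeff_C, PowerSeries.coeff_X]
      using this
  have hdvd : ∀ s n, u ^ s ∣ PowerSeries.coeff (n + 1) M := by
    intro s
    induction s with
    | zero => simp
    | succ s ih =>
      intro n
      have := hs (n + 1)
      rw [if_neg n.succ_ne_zero, sub_eq_zero] at this
      rw [this, pow_succ']
      exact mul_dvd_mul_left _ (ih _)
  have h1 : PowerSeries.coeff 1 M = 0 :=
    PowerSeries.eq_zero_of_forall_X_pow_dvd fun s => (pow_dvd_pow_of_dvd hu s).trans (hdvd s 0)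
  have h2 := hs 0
  rw [zero_add, h1, mul_zero, sub_zero, if_pos rfl] at h2
  simp only [sub_mul, map_sub, PowerSeries.coeff_zero_X_mul, PowerSeries.coeff_C_mul,
    PowerSeries.coeff_zero_X, mul_zero, PowerSeries.coeff_zero_C, zero_sub, neg_inj] at h0
  rw [← h0, h2, mul_comm]

/-- Factoring X - u out of the kernel takes the place of substituting u into the series G. -/
theorem eq_of_eval_eq_zero {k : Polynomial K⟦X⟧} {u α β : K⟦X⟧} (hu : PowerSeries.X ∣ u)
    (hk : k.eval u = 0) {G : (K⟦X⟧)⟦X⟧}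
    (h : (k : (K⟦X⟧)⟦X⟧) * G = PowerSeries.C α * PowerSeries.X - PowerSeries.C β) :
    β = α * u := by
  obtain ⟨q, rfl⟩ := Polynomial.dvd_iff_isRoot.2 hk
  refine eq_of_X_sub_C_mul hu (M := q * G) ?_
  rw [← h, Polynomial.coe_mul, Polynomial.coe_sub, Polynomial.coe_X, Polynomial.coe_C, mul_assoc]

/-- The kernel root is u = T/(1 + T): `hroot` is the kernel at u multiplied by (1 + T)^(e+2), and W
= (1 + W)u then gives W = u/(1 - u) = T. -/
theorem eq_of_kernel_equation (e : ℕ) {y W T : K⟦X⟧} {G : (K⟦X⟧)⟦X⟧}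
    (hT : PowerSeries.X ∣ T)
    (hroot : T * (1 + T) ^ e - PowerSeries.X * (1 + T) ^ (e + 2)
      + PowerSeries.X * T ^ (e + 2) - y * T ^ (e + 1) = 0)
    (hG : (PowerSeries.X - PowerSeries.X ^ 2 - PowerSeries.C PowerSeries.X
        + PowerSeries.C PowerSeries.X * PowerSeries.X ^ (e + 2)
        - PowerSeries.C y * (1 - PowerSeries.X) * PowerSeries.X ^ (e + 1)) * G
      = PowerSeries.C (PowerSeries.X * (1 + W)) * PowerSeries.X
        - PowerSeries.C (PowerSeries.X * W)) :
    W = T := by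
  have hc : PowerSeries.constantCoeff (1 + T) ≠ 0 := by
    rw [map_add, PowerSeries.X_dvd_iff.1 hT]
    simp
  obtain ⟨i, hi⟩ : ∃ i, (1 + T) * i = 1 := ⟨_, PowerSeries.mul_inv_cancel _ hc⟩
  have h := eq_of_eval_eq_zero (u := T * i) (G := G)
    (k := Polynomial.X - Polynomial.X ^ 2 - Polynomial.C PowerSeries.X
        + Polynomial.C PowerSeries.X * Polynomial.X ^ (e + 2)
        - Polynomial.C y * (1 - Polynomial.X) * Polynomial.X ^ (e + 1))
    (α := PowerSeries.X * (1 + W)) (β := PowerSeries.X * W) (hT.mul_right _) ?_ ?_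
  · have h' : W = (1 + W) * (T * i) := by
      refine mul_left_cancel₀ PowerSeries.X_ne_zero (h.trans (by ring))
    linear_combination (1 + T) * h' + (1 + W) * T * hi
  · have h1 : 1 - T * i = i := by linear_combination -hi
    have hpow : (1 + T) ^ e * i ^ e = 1 := by rw [← mul_pow, hi, one_pow]
    have hpow2 : (1 + T) ^ (e + 2) * i ^ (e + 2) = 1 := by rw [← mul_pow, hi, one_pow]
    simp only [Polynomial.eval_sub, Polynomial.eval_add, Polynomial.eval_mul, Polynomial.eval_pow,
      Polynomial.eval_X, Polynomial.eval_C, Polynomial.eval_one]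
    rw [h1]
    linear_combination i ^ (e + 2) * hroot - T * i ^ 2 * hpow + PowerSeries.X * hpow2
      + T * i * h1
  · rw [← hG]
    congr 1
    simp

end KernelMethod

/-! ### Encoding restricted Dyck paths as continuations with a remembered valley. -/

namespace RestrictedDyck

open DyckStep

/-- The list of steps leads from height `h` to height `0` without going below `0`. -/
def Descends : ℕ → List DyckStep → Prop
  | h, [] => h = 0
  | h, U :: l => Descends (h + 1) l
  | 0, D :: _ => False
  | h + 1, D :: l => Descends h l

theorem descends_iff (h : ℕ) (l : List DyckStep) :
    Descends h l ↔ h + l.count U = l.count D ∧ ∀ i, (l.take i).count D ≤ h + (l.take i).count U := by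
  induction l generalizing h with
  | nil => simp [Descends]
  | cons s l ih =>
    cases s with
    | U =>
      rw [Descends, ih]
      refine and_congr (by simp; omega) ⟨fun H i => ?_, fun H i => ?_⟩
      · rcases i with _ | i
        · simp
        · have := H i
          simp; omega
      · have := H (i + 1)
        simp at this; omega
    | D =>
      rcases h with _ | h
      · simp only [Descends, false_iff, not_and, not_forall]
        intro _
        exact ⟨1, by simp⟩
      · rw [Descends, ih]
        refine and_congr (by simp; omega) ⟨fun H i => ?_, fun H i => ?_⟩
        · rcases i with _ | i
          · simp
          · have := H i
            simp; omega
        · have := H (i + 1)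
          simp at this; omega

theorem valleysFrom_nonneg {h : ℕ} {l : List DyckStep} (hl : Descends h l) :
    ∀ z ∈ valleysFrom h l, 0 ≤ z := by
  induction l generalizing h with
  | nil => simp [valleysFrom]
  | cons s l ih =>
    cases s with
    | U =>
      intro z hz
      rw [Descends] at hl
      exact ih hl z (by simpa [valleysFrom] using hz)
    | D =>
      rcases h with _ | h
      · exact hl.elim
      · intro z hz
        rw [Descends] at hl
        simp only [valleysFrom, Nat.cast_add, Nat.cast_one, add_sub_cancel_right] at hz
        split_ifs at hz
        · rcases List.mem_cons.1 hz with rfl | hz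
          · exact Int.natCast_nonneg h
          · exact ih hl z hz
        · exact ih hl z hz

/-- `cons` as an embedding. -/
def consEmb (s : DyckStep) : List DyckStep ↪ List DyckStep := ⟨List.cons s, List.cons_injective⟩

/-- The continuations with `N` steps of a path at height `h` whose last valley has height `v`; the
Boolean tells whether the last step was a `D`. -/
def continuations (e : ℕ) : Bool → ℕ → ℕ → ℕ → Finset (List DyckStep)
  | _, 0, h, _ => if h = 0 then {[]} else ∅
  | false, N + 1, 0, v => (continuations e false N 1 v).map (consEmb U)
  | false, N + 1, h + 1, v =>
      (continuations e false N (h + 2) v).map (consEmb U)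
        ∪ (continuations e true N h v).map (consEmb D)
  | true, N + 1, 0, v =>
      if v ≤ e then (continuations e false N 1 0).map (consEmb U) else ∅
  | true, N + 1, h + 1, v =>
      (if v ≤ h + 1 + e then (continuations e false N (h + 2) (h + 1)).map (consEmb U) else ∅)
        ∪ (continuations e true N h v).map (consEmb D)

/-- The valleys of a path at height `h`, where the Boolean tells whether the step before was `D`. -/
def valleysAfter : Bool → ℕ → List DyckStep → List ℤ
  | false, h, l => valleysFrom h l
  | true, h, l => if l.head? = some U then (h : ℤ) :: valleysFrom h l else valleysFrom h l

/-- Consecutive entries drop by at most `e`. -/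
def Slow (e : ℕ) (L : List ℤ) : Prop := L.IsChain fun a b => -(e : ℤ) ≤ b - a

/-- A valley appears exactly when a U follows a D, so the last step, the height and the last valley
determine which first steps are allowed and the state they lead to. -/
theorem mem_continuations {e : ℕ} {b : Bool} {N h v : ℕ} {l : List DyckStep} :
    l ∈ continuations e b N h v ↔
      l.length = N ∧ Descends h l ∧ Slow e ((v : ℤ) :: valleysAfter b h l) := by
  induction l generalizing b N h v with
  | nil =>
    rcases N with _ | N
    · cases b <;> by_cases hh : h = 0 <;>
        simp [continuations, Descends, valleysAfter, valleysFrom, Slow, hh]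
    · cases b <;> rcases h with _ | h <;> simp only [continuations] <;>
        (try split_ifs) <;> simp [consEmb]
  | cons s l ih =>
    rcases N with _ | N
    · cases b <;> by_cases hh : h = 0 <;> simp [continuations, hh]
    · have hU : ∀ k : ℕ, valleysAfter false k (U :: l) = valleysAfter false (k + 1) l := by
        intro k
        simp [valleysAfter, valleysFrom]
      have hU' : ∀ k : ℕ, valleysAfter true k (U :: l) = (k : ℤ) :: valleysAfter false (k + 1) l := by
        intro k
        simp [valleysAfter, valleysFrom]
      have hD : ∀ (k : ℕ) (b : Bool),
          valleysAfter b (k + 1) (D :: l) = valleysAfter true k l := by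
        intro k b
        cases b <;> simp [valleysAfter, valleysFrom]
      have hmem : ∀ (s : DyckStep) (A : Finset (List DyckStep)),
          s :: l ∈ A.map (consEmb s) ↔ l ∈ A := fun s A => by simp [consEmb]
      have hUD : ∀ A : Finset (List DyckStep), U :: l ∉ A.map (consEmb D) :=
        fun A => by simp [consEmb]
      have hDU : ∀ A : Finset (List DyckStep), D :: l ∉ A.map (consEmb U) :=
        fun A => by simp [consEmb]
      have hslow : ∀ (a c : ℤ) (L : List ℤ), Slow e (a :: c :: L) ↔
          -(e : ℤ) ≤ c - a ∧ Slow e (c :: L) := fun a c L => by simp [Slow]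
      have hz : ∀ k : ℕ, (-(e : ℤ) ≤ (k : ℤ) - v) ↔ v ≤ k + e := fun k => by omega
      cases s with
      | U =>
        cases b with
        | false =>
          rcases h with _ | h
          · rw [continuations, hmem, ih, hU, Descends]
            simp
          · rw [continuations, Finset.mem_union, hmem, ih, hU, Descends]
            simp [hUD]
        | true =>
          rcases h with _ | h
          · rw [continuations, hU', Descends, hslow, hz]
            split_ifs with hv
            · rw [hmem, ih]
              simp [hv]
            · simp [hv]
          · rw [continuations, hU', Descends, Finset.mem_union, hslow, hz]
            split_ifs with hv
            · rw [hmem, ih]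
              simp [hUD, hv]
            · simp [hUD, hv]
      | D =>
        rcases h with _ | h
        · cases b
          · simp only [continuations, hDU, Descends]
            simp
          · simp only [continuations, Descends]
            split_ifs <;> simp [hDU]
        · rw [hD, Descends]
          cases b
          · rw [continuations, Finset.mem_union, hmem, ih]
            simp [hDU]
          · rw [continuations, Finset.mem_union, hmem, ih]
            split_ifs <;> simp [hDU]

theorem card_restricted (e n : ℕ) :
    (Finset.univ.filter fun p : {p : DyckWord // p.semilength = n} =>
      p.1.IsRestricted (-(e : ℤ))).card = (continuations e true (2 * n) 0 0).card := by
  have hlen : ∀ p : DyckWord, p.toList.length = 2 * p.semilength := fun p => by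
    rw [DyckWord.two_mul_semilength_eq_length]
  have hdesc : ∀ p : DyckWord, Descends 0 p.toList := fun p =>
    (descends_iff 0 _).2 ⟨by simpa using p.count_U_eq_count_D, by
      simpa using p.count_D_le_count_U⟩
  have hslow : ∀ p : DyckWord, p.IsRestricted (-(e : ℤ)) ↔
      Slow e (((0 : ℕ) : ℤ) :: valleysAfter true 0 p.toList) := by
    intro p
    have hnn := valleysFrom_nonneg (hdesc p)
    rw [DyckWord.IsRestricted, DyckWord.valleys]
    simp only [Slow, valleysAfter, Nat.cast_zero] at hnn ⊢
    -- The origin is treated as a valley of height 0. This adds no constraint, since every actual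
    -- valley has height at least 0 ≥ -e.
    have key : (valleysFrom 0 p.toList).IsChain (fun a b => -(e : ℤ) ≤ b - a) ↔
        ((0 : ℤ) :: valleysFrom 0 p.toList).IsChain (fun a b => -(e : ℤ) ≤ b - a) := by
      rw [List.isChain_cons]
      refine ⟨fun H => ⟨fun y hy => ?_, H⟩, fun H => H.2⟩
      have := hnn y (List.mem_of_mem_head? hy)
      omega
    split_ifs
    · rw [List.isChain_cons_cons, ← key]
      simp
    · exact key
  refine Finset.card_bij (fun p _ => p.1.toList) ?_ ?_ ?_
  · intro p hp
    rw [Finset.mem_filter] at hp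
    rw [mem_continuations]
    exact ⟨by rw [hlen, p.2], hdesc _, (hslow _).1 hp.2⟩
  · intro p _ q _ h
    exact Subtype.ext (DyckWord.ext h)
  · intro l hl
    rw [mem_continuations] at hl
    obtain ⟨h1, h2, h3⟩ := hl
    have h2' := (descends_iff 0 _).1 h2
    let p : DyckWord := ⟨l, by simpa using h2'.1, by simpa using h2'.2⟩
    have hp : p.semilength = n := by
      have := hlen p
      change l.length = _ at this
      omega
    exact ⟨⟨p, hp⟩, by simpa using (hslow p).2 h3, rfl⟩

theorem coeff_one_add_atYOne_dyckGF (e n : ℕ) :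
    PowerSeries.coeff n (1 + atYOne (dyckGF (-(e : ℤ))))
      = ((continuations e true (2 * n) 0 0).card : ℚ) := by
  have hcoeff : PowerSeries.coeff n (atYOne (dyckGF (-(e : ℤ)))) =
      (Finset.univ.filter fun p : {p : DyckWord // p.semilength = n} =>
        p.1 ≠ 0 ∧ p.1.IsRestricted (-(e : ℤ))).card := by
    rw [atYOne, PowerSeries.coeff_map, dyckGF, PowerSeries.coeff_mk]
    simp
  rw [map_add, hcoeff]
  rcases Nat.eq_zero_or_pos n with rfl | hn
  · have h0 : ∀ p : {p : DyckWord // p.semilength = 0}, p.1 = 0 := fun p => by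
      rw [← DyckWord.toList_eq_nil, ← List.length_eq_zero_iff,
        ← DyckWord.two_mul_semilength_eq_length, p.2]
    simp [h0, continuations]
  · have hne : ∀ p : {p : DyckWord // p.semilength = n}, p.1 ≠ 0 := by
      rintro ⟨p, hp⟩ rfl
      simp at hp
      omega
    rw [← card_restricted]
    simp [hne, PowerSeries.coeff_one, hn.ne']

/-! ### Generating functions of continuations and the kernel equation. -/

theorem continuations_eq_empty {e : ℕ} {b : Bool} {N h v : ℕ} (hN : N < h) :
    continuations e b N h v = ∅ := by
  refine Finset.eq_empty_of_forall_notMem fun l hl => ?_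
  rw [mem_continuations] at hl
  have h1 := ((descends_iff h l).1 hl.2.1).1
  have h2 : l.count D ≤ l.length := List.count_le_length
  omega

theorem card_map_union_map (A B : Finset (List DyckStep)) :
    (A.map (consEmb U) ∪ B.map (consEmb D)).card = A.card + B.card := by
  rw [Finset.card_union_of_disjoint, Finset.card_map, Finset.card_map]
  rw [Finset.disjoint_left]
  intro l hA hB
  obtain ⟨a, -, rfl⟩ := Finset.mem_map.1 hA
  obtain ⟨b, -, hb⟩ := Finset.mem_map.1 hB
  simp [consEmb] at hb

/-- The generating function, by number of up steps, of the continuations from height `h` when the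
last valley has height `v`. -/
noncomputable def contGF (e : ℕ) (b : Bool) (h v : ℕ) : ℚ⟦X⟧ :=
  PowerSeries.mk fun n => ((continuations e b (2 * n + h) h v).card : ℚ)

/-- The generating function of the continuations from a valley of height `h`. -/
noncomputable def valleyGF (e h : ℕ) : ℚ⟦X⟧ := PowerSeries.X * contGF e false (h + 1) h

/-- From height h + 2, a descent in 2n + h steps has n - 1 up steps, whence the factor x; for n = 0
there are too few steps. -/
theorem coeff_X_mul_contGF (e : ℕ) (b : Bool) (h v n : ℕ) :
    PowerSeries.coeff n (PowerSeries.X * contGF e b (h + 2) v)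
      = ((continuations e b (2 * n + h) (h + 2) v).card : ℚ) := by
  rcases n with _ | n
  · rw [PowerSeries.coeff_zero_X_mul, continuations_eq_empty (by omega)]
    simp
  · rw [PowerSeries.coeff_succ_X_mul, contGF, PowerSeries.coeff_mk]
    congr 3
    ring

theorem contGF_false (e h v : ℕ) :
    contGF e false (h + 1) v = PowerSeries.X * contGF e false (h + 2) v + contGF e true h v := by
  ext n
  rw [map_add, coeff_X_mul_contGF, contGF, contGF, PowerSeries.coeff_mk, PowerSeries.coeff_mk,
    ← add_assoc, continuations, card_map_union_map, Nat.cast_add]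

theorem contGF_true_succ (e h v : ℕ) :
    contGF e true (h + 1) v
      = (if v ≤ h + 1 + e then valleyGF e (h + 1) else 0) + contGF e true h v := by
  ext n
  rw [map_add, contGF, contGF, PowerSeries.coeff_mk, PowerSeries.coeff_mk, ← add_assoc,
    continuations]
  split_ifs with hv
  · rw [valleyGF, coeff_X_mul_contGF, card_map_union_map, Nat.cast_add]
  · simp

theorem contGF_true_zero (e v : ℕ) :
    contGF e true 0 v = 1 + if v ≤ e then valleyGF e 0 else 0 := by
  ext n
  rw [map_add, contGF, PowerSeries.coeff_mk, PowerSeries.coeff_one]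
  rcases n with _ | n
  · simp [continuations, valleyGF, apply_ite]
  · rw [if_neg n.succ_ne_zero, zero_add, show 2 * (n + 1) + 0 = (2 * n + 1) + 1 by ring,
      continuations]
    split_ifs with hv
    · rw [valleyGF, PowerSeries.coeff_succ_X_mul, contGF, PowerSeries.coeff_mk, Finset.card_map]
    · simp

theorem one_add_atYOne_dyckGF (e : ℕ) :
    1 + atYOne (dyckGF (-(e : ℤ))) = contGF e true 0 0 := by
  ext n
  rw [coeff_one_add_atYOne_dyckGF, contGF, PowerSeries.coeff_mk, add_zero]

theorem atYOne_dyckGF (e : ℕ) : atYOne (dyckGF (-(e : ℤ))) = valleyGF e 0 := by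
  have h := one_add_atYOne_dyckGF e
  rw [contGF_true_zero, if_pos (Nat.zero_le e)] at h
  exact add_left_cancel h

/-- The coefficients of `u ^ e * ∑ F_m u ^ m`, where `F_m = valleyGF e m`. -/
noncomputable def shiftedValleyGF (e m : ℕ) : ℚ⟦X⟧ := if e ≤ m then valleyGF e (m - e) else 0

/-- Only continuations whose next valley has height exactly m - e are lost, and a descent from h
meets that height just when e ≤ m ≤ h + e. -/
theorem contGF_true_sub (e h m : ℕ) :
    contGF e true h m - contGF e true h (m + 1)
      = if m ≤ h + e then shiftedValleyGF e m else 0 := by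
  rw [shiftedValleyGF]
  induction h with
  | zero =>
    rw [contGF_true_zero, contGF_true_zero]
    rcases lt_trichotomy m e with h | rfl | h
    · simp [h.le, Nat.succ_le_of_lt h, h.not_ge]
    · simp
    · simp [h.not_ge, (h.trans m.lt_succ_self).not_ge]
  | succ h ih =>
    rw [contGF_true_succ, contGF_true_succ, add_sub_add_comm, ih]
    rcases lt_trichotomy m (h + 1 + e) with hm | rfl | hm
    · simp [hm.le, Nat.succ_le_of_lt hm, show m ≤ h + e by omega]
    · simp [show ¬ h + 1 + e ≤ h + e by omega]
    · simp [hm.not_ge, (hm.trans m.lt_succ_self).not_ge, show ¬ m ≤ h + e by omega]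

/-- The path may climb any number of further steps before descending to the lost valley, which gives
the geometric factor 1/(1 - x). The error is x times the error at the next height, hence divisible
by every power of x. -/
theorem contGF_false_sub (e m h : ℕ) (hm : m ≤ h) :
    (1 - PowerSeries.X) * (contGF e false (h + 1) m - contGF e false (h + 1) (m + 1))
      = shiftedValleyGF e m := by
  rw [← sub_eq_zero]
  refine PowerSeries.eq_zero_of_forall_X_pow_dvd fun s => ?_
  induction s generalizing h with
  | zero => simp
  | succ s ih =>
    have hc := contGF_true_sub e h m
    rw [if_pos (by omega)] at hc
    have : (1 - PowerSeries.X) * (contGF e false (h + 1) m - contGF e false (h + 1) (m + 1))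
        - shiftedValleyGF e m
      = PowerSeries.X * ((1 - PowerSeries.X) * (contGF e false (h + 1 + 1) m
        - contGF e false (h + 1 + 1) (m + 1)) - shiftedValleyGF e m) := by
      rw [contGF_false, contGF_false e h (m + 1)]
      linear_combination (1 - PowerSeries.X) * hc
    rw [this, pow_succ']
    exact mul_dvd_mul_left _ (ih _ (by omega))

theorem contGF_true_diag_succ (e m : ℕ) :
    contGF e true (m + 1) (m + 1) - contGF e true m m
      = valleyGF e (m + 1) - shiftedValleyGF e m := by
  have hc := contGF_true_sub e m m
  rw [if_pos (by omega)] at hc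
  rw [contGF_true_succ, if_pos (by omega)]
  linear_combination -hc

/-- After a valley at m and a step U, the path either turns down or climbs again; the climbing parts
for remembered heights m and m + 1 differ by the previous lemma, so y = x²/(1 - x). -/
theorem valleyGF_sub (e m : ℕ) {y : ℚ⟦X⟧} (hy : y * (1 - PowerSeries.X) = PowerSeries.X ^ 2) :
    valleyGF e m - PowerSeries.X * valleyGF e (m + 1)
      = PowerSeries.X * contGF e true m m + y * shiftedValleyGF e m := by
  have h := contGF_false_sub e m (m + 1) (by omega)
  rw [valleyGF, valleyGF, contGF_false, ← h]
  linear_combination (contGF e false (m + 1 + 1) (m + 1) - contGF e false (m + 1 + 1) m) * hy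

theorem kernel_equation (e : ℕ) {y : ℚ⟦X⟧} (hy : y * (1 - PowerSeries.X) = PowerSeries.X ^ 2) :
    (PowerSeries.X - PowerSeries.X ^ 2 - PowerSeries.C PowerSeries.X
        + PowerSeries.C PowerSeries.X * PowerSeries.X ^ (e + 2)
        - PowerSeries.C y * (1 - PowerSeries.X) * PowerSeries.X ^ (e + 1))
        * PowerSeries.mk (valleyGF e)
      = PowerSeries.C (PowerSeries.X * (1 + valleyGF e 0)) * PowerSeries.X
        - PowerSeries.C (PowerSeries.X * valleyGF e 0) := by
  set G := PowerSeries.mk (valleyGF e) with hG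
  set H := PowerSeries.mk fun m => contGF e true m m with hH
  have hshift : ∀ m, PowerSeries.coeff m (PowerSeries.X ^ e * G) = shiftedValleyGF e m := by
    intro m
    rw [PowerSeries.coeff_X_pow_mul', shiftedValleyGF, hG, PowerSeries.coeff_mk]
  have h1 : PowerSeries.X * G - PowerSeries.C PowerSeries.X * (G - PowerSeries.C (valleyGF e 0))
      = PowerSeries.C PowerSeries.X * (PowerSeries.X * H)
        + PowerSeries.C y * (PowerSeries.X * (PowerSeries.X ^ e * G)) := by
    ext1 n
    rcases n with _ | m
    · simp [hG]
    · simp only [map_sub, map_add, PowerSeries.coeff_C_mul, PowerSeries.coeff_succ_X_mul, hshift]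
      simp only [hG, hH, PowerSeries.coeff_mk, PowerSeries.coeff_C, if_neg m.succ_ne_zero, sub_zero]
      exact valleyGF_sub e m hy
  have h2 : H - PowerSeries.X * H = 1 + G - PowerSeries.X * (PowerSeries.X ^ e * G) := by
    ext1 n
    rcases n with _ | m
    · simp [hG, hH, contGF_true_zero]
    · simp only [map_sub, map_add, PowerSeries.coeff_succ_X_mul, hshift, PowerSeries.coeff_one,
        if_neg m.succ_ne_zero, zero_add]
      simp only [hG, hH, PowerSeries.coeff_mk]
      exact contGF_true_diag_succ e m
  simp only [map_mul, map_add, map_one]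
  -- Eliminates the diagonal series H between `h1` and `h2`.
  linear_combination (1 - PowerSeries.X) * h1 + PowerSeries.C PowerSeries.X * PowerSeries.X * h2

end RestrictedDyck

/-! ### The explicit polynomial P and its Lagrange coefficients. -/

namespace RestrictedDyck

open Polynomial

theorem tupleSum_le {e n : ℕ} (hn : 1 ≤ n) {i : ℕ →₀ ℕ} (hi : i ∈ indexTuples e n) :
    tupleSum e i ≤ n := by
  have h1 : tupleSum e i ≤ ∑ j ∈ Finset.Icc 2 (e + 1), j * i j :=
    Finset.sum_le_sum fun j hj => Nat.le_mul_of_pos_left _ (by have := (Finset.mem_Icc.1 hj).1; omega)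
  rw [((mem_indexTuples hn i).1 hi).2] at h1
  omega

theorem multinom_eq_multinomial {e n : ℕ} {i k : ℕ → ℕ}
    (hk0 : k 0 = n - ∑ j ∈ Finset.Icc 2 (e + 1), i j)
    (hle : ∑ j ∈ Finset.Icc 2 (e + 1), i j ≤ n) (hk : ∀ j ∈ Finset.Icc 2 (e + 1), k j = i j) :
    (n.factorial : ℚ) / ((∏ j ∈ Finset.Icc 2 (e + 1), ((i j).factorial : ℚ))
        * ((n - ∑ j ∈ Finset.Icc 2 (e + 1), i j).factorial : ℚ))
      = (Nat.multinomial (insert 0 (Finset.Icc 2 (e + 1))) k : ℚ) := by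
  have hspec := Nat.multinomial_spec (insert 0 (Finset.Icc 2 (e + 1))) k
  rw [Finset.prod_insert (by simp), Finset.sum_insert (by simp), Finset.sum_congr rfl hk,
    Finset.prod_congr rfl fun j hj => by rw [hk j hj], hk0, Nat.sub_add_cancel hle] at hspec
  rw [div_eq_iff]
  · rw [← hspec]
    push_cast
    ring
  · exact mul_ne_zero (Finset.prod_ne_zero_iff.2 fun j _ => by positivity) (by positivity)

/-- Multinomial theorem: a tuple is completed by the index 0, counting the n - ∑ i_j factors in
which the constant term x is chosen. -/
theorem coeff_pow_eq_sum_indexTuples {R : Type*} [CommRing R] [Algebra ℚ R] (e : ℕ) {n : ℕ}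
    (hn : 1 ≤ n) (x : R) (a : ℕ → R) :
    ((C x + ∑ j ∈ Finset.Icc 2 (e + 1), C (a j) * X ^ j) ^ n).coeff (n - 1)
      = ∑ i ∈ indexTuples e n, algebraMap ℚ R (multinom e n i) * x ^ (n - tupleSum e i)
          * ∏ j ∈ Finset.Icc 2 (e + 1), a j ^ i j := by
  classical
  set s := insert 0 (Finset.Icc 2 (e + 1)) with hs
  set b : ℕ → R := fun j => if j = 0 then x else a j with hb
  have h0 : (0 : ℕ) ∉ Finset.Icc 2 (e + 1) := by simp
  have hne : ∀ j ∈ Finset.Icc 2 (e + 1), j ≠ 0 := fun j hj h => h0 (h ▸ hj)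
  have hbase : C x + ∑ j ∈ Finset.Icc 2 (e + 1), C (a j) * X ^ j
      = ∑ j ∈ s, C (b j) * X ^ j := by
    rw [hs, Finset.sum_insert h0]
    congr 1
    · simp [hb]
    · exact Finset.sum_congr rfl fun j hj => by simp [hb, hne j hj]
  have hterm : ∀ k : ℕ → ℕ, ((Nat.multinomial s k : Polynomial R) *
      ∏ j ∈ s, (C (b j) * X ^ j) ^ k j).coeff (n - 1)
      = if ∑ j ∈ s, j * k j = n - 1 then (Nat.multinomial s k : R) * ∏ j ∈ s, b j ^ k j
        else 0 := by
    intro k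
    rw [coeff_natCast_mul]
    simp only [mul_pow, Finset.prod_mul_distrib, ← pow_mul, Finset.prod_pow_eq_pow_sum, ← C_pow,
      ← map_prod, coeff_C_mul, coeff_X_pow, eq_comm (a := n - 1)]
    split_ifs <;> simp
  rw [hbase, Finset.sum_pow_eq_sum_piAntidiag, finsetSum_coeff, Finset.sum_congr rfl
    fun k _ => hterm k, ← Finset.sum_filter]
  symm
  refine Finset.sum_bij (fun i _ => fun j => if j = 0 then n - tupleSum e i else i j) ?_ ?_ ?_ ?_
  · intro i hi
    have hle := tupleSum_le hn hi
    obtain ⟨hsupp, hsum⟩ := (mem_indexTuples hn i).1 hi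
    rw [Finset.mem_filter, Finset.mem_piAntidiag, hs, Finset.sum_insert h0, Finset.sum_insert h0]
    refine ⟨⟨?_, ?_⟩, ?_⟩
    · rw [Finset.sum_congr rfl fun j hj => if_neg (hne j hj), if_pos rfl]
      exact Nat.sub_add_cancel hle
    · intro j hj
      by_cases hj0 : j = 0
      · simp [hj0]
      · rw [if_neg hj0] at hj
        exact Finset.mem_insert_of_mem (hsupp (Finsupp.mem_support_iff.2 hj))
    · rw [Finset.sum_congr rfl fun j hj =>
        show j * (if j = 0 then n - tupleSum e i else i j) = j * i j by rw [if_neg (hne j hj)], hsum]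
      simp
  · intro i hi i' hi' h
    ext j
    by_cases hj : j = 0
    · subst hj
      have hz : ∀ i ∈ indexTuples e n, i 0 = 0 := fun i hi =>
        Finsupp.notMem_support_iff.1 fun hm => h0 (((mem_indexTuples hn i).1 hi).1 hm)
      rw [hz i hi, hz i' hi']
    · simpa [hj] using congrFun h j
  · intro k hk
    rw [Finset.mem_filter, Finset.mem_piAntidiag, hs, Finset.sum_insert h0,
      Finset.sum_insert h0] at hk
    obtain ⟨⟨hk1, hk2⟩, hk3⟩ := hk
    have hval : ∀ j ∈ Finset.Icc 2 (e + 1),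
        (Finsupp.indicator (Finset.Icc 2 (e + 1)) fun j _ => k j) j = k j := fun j hj =>
      Finsupp.indicator_of_mem hj _
    have hts : tupleSum e (Finsupp.indicator (Finset.Icc 2 (e + 1)) fun j _ => k j)
        = ∑ j ∈ Finset.Icc 2 (e + 1), k j := Finset.sum_congr rfl hval
    refine ⟨Finsupp.indicator (Finset.Icc 2 (e + 1)) fun j _ => k j, ?_, ?_⟩
    · rw [mem_indexTuples hn]
      refine ⟨fun j hj => ?_, ?_⟩
      · by_contra hj'
        exact Finsupp.mem_support_iff.1 hj (Finsupp.indicator_of_notMem hj' _)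
      · rw [Finset.sum_congr rfl fun j hj => by rw [hval j hj]]
        simpa using hk3
    · ext j
      rw [hts]
      split_ifs with hj
      · rw [hj]
        omega
      · by_cases hj' : j ∈ Finset.Icc 2 (e + 1)
        · exact hval j hj'
        · rw [Finsupp.indicator_of_notMem hj']
          by_contra hkj
          exact (Finset.mem_insert.1 (hk2 j (Ne.symm hkj))).elim hj hj'
  · intro i hi
    have hle := tupleSum_le hn hi
    rw [multinom, tupleSum, multinom_eq_multinomial (k := fun j => if j = 0 then
      n - tupleSum e i else i j) (by simp [tupleSum]) hle fun j hj => if_neg (hne j hj)]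
    rw [map_natCast, mul_assoc]
    congr 1
    rw [hs, Finset.prod_insert h0]
    refine congrArg₂ _ (by simp [hb]) (Finset.prod_congr rfl fun j hj => ?_)
    simp [hb, hne j hj]

/-- The coefficients, for `j ≥ 2`, of the polynomial equation satisfied by `L_e(x, 1)`. -/
noncomputable def lagrangeCoeff (e j : ℕ) : ℚ⟦X⟧ :=
  if j = e + 1 then tSeries e
  else PowerSeries.X * ((e + 2).choose j : ℚ⟦X⟧) - (e.choose (j - 1) : ℚ⟦X⟧)

/-- The polynomial `P` over `ℚ⟦x⟧` such that `T = L_e(x, 1)` solves `T = P(T)`. -/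
noncomputable def lagrangePoly (e : ℕ) : Polynomial ℚ⟦X⟧ :=
  C (1 - ((e : ℚ⟦X⟧) + 2) * PowerSeries.X)⁻¹ *
    (C PowerSeries.X + ∑ j ∈ Finset.Icc 2 (e + 1), C (lagrangeCoeff e j) * X ^ j)

theorem X_dvd_lagrangePoly_coeff_zero (e : ℕ) : PowerSeries.X ∣ (lagrangePoly e).coeff 0 := by
  have h : ∀ j ∈ Finset.Icc 2 (e + 1), (C (lagrangeCoeff e j) * X ^ j).coeff 0 = 0 := by
    intro j hj
    have := (Finset.mem_Icc.1 hj).1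
    simp [coeff_X_pow, show ¬ 0 = j by omega]
  rw [lagrangePoly, coeff_C_mul, coeff_add, finsetSum_coeff, Finset.sum_eq_zero h, add_zero,
    coeff_C_zero]
  exact Dvd.intro_left _ rfl

theorem lagrangePoly_coeff_one (e : ℕ) : (lagrangePoly e).coeff 1 = 0 := by
  have h : ∀ j ∈ Finset.Icc 2 (e + 1), (C (lagrangeCoeff e j) * X ^ j).coeff 1 = 0 := by
    intro j hj
    have := (Finset.mem_Icc.1 hj).1
    simp [coeff_X_pow, show ¬ 1 = j by omega]
  rw [lagrangePoly, coeff_C_mul, coeff_add, finsetSum_coeff, Finset.sum_eq_zero h, add_zero,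
    coeff_C_succ, mul_zero]

theorem prod_lagrangeCoeff {e : ℕ} (he : 1 ≤ e) (i : ℕ → ℕ) :
    ∏ j ∈ Finset.Icc 2 (e + 1), lagrangeCoeff e j ^ i j
      = tSeries e ^ i (e + 1) * ∏ j ∈ Finset.Icc 2 e,
          (PowerSeries.X * ((e + 2).choose j : ℚ⟦X⟧) - (e.choose (j - 1) : ℚ⟦X⟧)) ^ i j := by
  rw [Finset.prod_Icc_succ_top (by omega), mul_comm, lagrangeCoeff, if_pos rfl]
  congr 1
  refine Finset.prod_congr rfl fun j hj => ?_
  rw [lagrangeCoeff, if_neg (by have := (Finset.mem_Icc.1 hj).2; omega)]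

theorem natCast_inv_eq_C (n : ℕ) : ((n : ℚ⟦X⟧))⁻¹ = PowerSeries.C ((n : ℚ)⁻¹) := by
  rw [← map_natCast (PowerSeries.C (R := ℚ)), PowerSeries.C_inv]

theorem inv_pow (f : ℚ⟦X⟧) (n : ℕ) : (f ^ n)⁻¹ = f⁻¹ ^ n := by
  induction n with
  | zero => simp
  | succ n ih => rw [pow_succ, PowerSeries.mul_inv_rev, ih, pow_succ']

theorem term_lagrangePoly {e : ℕ} (he : 1 ≤ e) {n : ℕ} (hn : 1 ≤ n) :
    LagrangeInversion.term (lagrangePoly e) 1 n =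
      (∑ i ∈ indexTuples e n,
          PowerSeries.C (multinom e n i)
            * PowerSeries.X ^ (n - tupleSum e i)
            * tSeries e ^ i (e + 1)
            * ∏ j ∈ Finset.Icc 2 e,
                (PowerSeries.X * ((e + 2).choose j : ℚ⟦X⟧) - (e.choose (j - 1) : ℚ⟦X⟧)) ^ i j)
          * ((n : ℚ⟦X⟧) * (1 - ((e : ℚ⟦X⟧) + 2) * PowerSeries.X) ^ n)⁻¹ := by
  have hcoeff : (X * lagrangePoly e ^ n).coeff n = (lagrangePoly e ^ n).coeff (n - 1) := by
    conv_lhs => rw [← Nat.sub_add_cancel hn, coeff_X_mul, Nat.sub_add_cancel hn]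
  rw [LagrangeInversion.term, if_neg (by omega), pow_one, hcoeff, lagrangePoly, mul_pow,
    ← C_pow, coeff_C_mul, coeff_pow_eq_sum_indexTuples e hn, PowerSeries.mul_inv_rev, natCast_inv_eq_C, inv_pow,
    Nat.cast_one, one_div]
  rw [← mul_assoc, mul_comm]
  congr 1
  · refine Finset.sum_congr rfl fun i _ => ?_
    rw [prod_lagrangeCoeff he, mul_assoc, mul_assoc, mul_assoc]
    rfl
  · exact mul_comm _ _

/-- The binomial expansion without its terms j = 0, 1, e + 1, e + 2; the last two are treated apart
because the coefficient of T^(e+1) is t and the T^(e+2) terms cancel. -/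
theorem sum_choose_Icc {R : Type*} [CommRing R] (e : ℕ) (he : 1 ≤ e) (T : R) :
    ∑ j ∈ Finset.Icc 2 e, ((e + 2).choose j : R) * T ^ j
      = (1 + T) ^ (e + 2) - 1 - ((e : R) + 2) * T - ((e : R) + 2) * T ^ (e + 1) - T ^ (e + 2) := by
  obtain ⟨k, rfl⟩ : ∃ k, e = k + 1 := ⟨e - 1, by omega⟩
  rw [add_comm 1 T, add_pow, Finset.sum_range_succ, Finset.sum_range_succ, Finset.sum_range_succ',
    Finset.sum_range_succ', ← Finset.Ico_add_one_right_eq_Icc, Finset.sum_Ico_eq_sum_range]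
  simp only [one_pow, mul_one, Nat.choose_zero_right, zero_add, Nat.choose_one_right,
    Nat.choose_self]
  rw [show (k + 1 + 2).choose (k + 1 + 1) = k + 1 + 2 from Nat.choose_succ_self_right (k + 2),
    show k + 1 + 1 - 2 = k by omega]
  have : ∀ i, ((k + 1 + 2).choose (2 + i) : R) * T ^ (2 + i)
      = T ^ (i + 1 + 1) * ((k + 1 + 2).choose (i + 1 + 1) : R) := fun i => by
    rw [show 2 + i = i + 1 + 1 by ring, mul_comm]
  rw [Finset.sum_congr rfl fun i _ => this i]
  push_cast
  ring

theorem sum_choose_pred_Icc {R : Type*} [CommRing R] (e : ℕ) (he : 1 ≤ e) (T : R) :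
    ∑ j ∈ Finset.Icc 2 e, (e.choose (j - 1) : R) * T ^ j = T * ((1 + T) ^ e - 1 - T ^ e) := by
  obtain ⟨k, rfl⟩ : ∃ k, e = k + 1 := ⟨e - 1, by omega⟩
  rw [add_comm 1 T, add_pow, Finset.sum_range_succ, Finset.sum_range_succ',
    ← Finset.Ico_add_one_right_eq_Icc, Finset.sum_Ico_eq_sum_range,
    show k + 1 + 1 - 2 = k by omega]
  have : ∀ i, ((k + 1).choose (2 + i - 1) : R) * T ^ (2 + i)
      = T * (T ^ (i + 1) * ((k + 1).choose (i + 1) : R)) := fun i => by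
    rw [show 2 + i - 1 = i + 1 by omega]
    ring
  rw [Finset.sum_congr rfl fun i _ => this i, ← Finset.mul_sum]
  simp only [one_pow, mul_one, Nat.choose_zero_right, Nat.choose_self, pow_zero, Nat.cast_one]
  ring

/-- Multiplying T = P(T) by 1 - (e+2)x and collecting binomial sums gives the kernel with y = x²/(1
- x), because t = (e+2)x - 1 + x²/(1 - x). -/
theorem kernel_root_of_eval_lagrangePoly {e : ℕ} (he : 1 ≤ e) {T : ℚ⟦X⟧}
    (hT : (lagrangePoly e).eval T = T) :
    T * (1 + T) ^ e - PowerSeries.X * (1 + T) ^ (e + 2) + PowerSeries.X * T ^ (e + 2)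
      - PowerSeries.X ^ 2 * (1 - PowerSeries.X)⁻¹ * T ^ (e + 1) = 0 := by
  have hq : (1 - ((e : ℚ⟦X⟧) + 2) * PowerSeries.X) *
      (1 - ((e : ℚ⟦X⟧) + 2) * PowerSeries.X)⁻¹ = 1 :=
    PowerSeries.mul_inv_cancel _ (by simp)
  have hX : (1 - PowerSeries.X : ℚ⟦X⟧) * (1 - PowerSeries.X)⁻¹ = 1 :=
    PowerSeries.mul_inv_cancel _ (by simp)
  have hsum : ∑ j ∈ Finset.Icc 2 e, lagrangeCoeff e j * T ^ j
      = PowerSeries.X * ∑ j ∈ Finset.Icc 2 e, ((e + 2).choose j : ℚ⟦X⟧) * T ^ j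
        - ∑ j ∈ Finset.Icc 2 e, (e.choose (j - 1) : ℚ⟦X⟧) * T ^ j := by
    rw [Finset.mul_sum, ← Finset.sum_sub_distrib]
    refine Finset.sum_congr rfl fun j hj => ?_
    rw [lagrangeCoeff, if_neg (by have := (Finset.mem_Icc.1 hj).2; omega)]
    ring
  rw [lagrangePoly, eval_C_mul, eval_add, eval_C, eval_finsetSum] at hT
  simp only [eval_C_mul, eval_pow, eval_X] at hT
  rw [Finset.sum_Icc_succ_top (by omega), hsum, sum_choose_Icc e he, sum_choose_pred_Icc e he,
    lagrangeCoeff, if_pos rfl, tSeries] at hT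
  have h := congrArg ((1 - ((e : ℚ⟦X⟧) + 2) * PowerSeries.X) * ·) hT
  rw [← mul_assoc, hq, one_mul] at h
  linear_combination -h + (((e : ℚ⟦X⟧) + 2) * PowerSeries.X - 1) * T ^ (e + 1) * hX

end RestrictedDyck

theorem theorem2p3 (d : ℤ) (hd : d < 0) (e : ℕ) (he : (e : ℤ) = |d|) :
    HasFormalSum
      (fun n : ℕ+ =>
        (∑ i ∈ indexTuples e n,
          PowerSeries.C (multinom e n i)
            * PowerSeries.X ^ ((n : ℕ) - tupleSum e i)
            * tSeries e ^ i (e + 1)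
            * ∏ j ∈ Finset.Icc 2 e,
                (PowerSeries.X * ((e + 2).choose j : ℚ⟦X⟧) - (e.choose (j - 1) : ℚ⟦X⟧)) ^ i j)
          * (((n : ℕ) : ℚ⟦X⟧) * (1 - ((e : ℚ⟦X⟧) + 2) * PowerSeries.X) ^ (n : ℕ))⁻¹)
      (atYOne (dyckGF d)) := by
  have hde : d = -(e : ℤ) := by rw [he, abs_of_neg hd, neg_neg]
  have he1 : 1 ≤ e := by omega
  subst hde
  let τ : TopologicalSpace ℚ := ⊥
  obtain ⟨T, hsum, hXT, hT⟩ := @LagrangeInversion.exists_hasSum ℚ _ τ _ ⟨rfl⟩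
    (RestrictedDyck.lagrangePoly e) (RestrictedDyck.X_dvd_lagrangePoly_coeff_zero e)
    (RestrictedDyck.lagrangePoly_coeff_one e)
  have hy : PowerSeries.X ^ 2 * (1 - PowerSeries.X : ℚ⟦X⟧)⁻¹ * (1 - PowerSeries.X)
      = PowerSeries.X ^ 2 := by
    rw [mul_assoc, PowerSeries.inv_mul_cancel _ (by simp), mul_one]
  have hW : RestrictedDyck.valleyGF e 0 = T :=
    KernelMethod.eq_of_kernel_equation e hXT
      (RestrictedDyck.kernel_root_of_eval_lagrangePoly he1 hT)
      (RestrictedDyck.kernel_equation e hy)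
  rw [RestrictedDyck.atYOne_dyckGF, hW]
  let _ : TopologicalSpace ℚ⟦X⟧ := @PowerSeries.WithPiTopology.instTopologicalSpace ℚ ⊥
  change HasSum _ T
  have hpos : HasSum (fun n : ℕ+ => LagrangeInversion.term (RestrictedDyck.lagrangePoly e) 1 n) T := by
    -- Summing over positive n loses nothing: for k = 1 the term at n = 0 is zero.
    refine (Function.Injective.hasSum_iff PNat.coe_injective fun n hn => ?_).2 hsum
    rcases Nat.eq_zero_or_pos n with rfl | h
    · simp [LagrangeInversion.term]
    · exact absurd ⟨⟨n, h⟩, rfl⟩ hn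
  convert hpos using 2 with n
  exact (RestrictedDyck.term_lagrangePoly he1 n.pos).symm
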